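/- For rational numbers $a,b,c$ with $c\notin\{0,-1,-2,\dots\}$ let \[ {}_2F_1(a,b;c;x)=\sum_{n\ge 0}\frac{(a)_n(b)_n}{(c)_n}\,\frac{x^n}{n!}\in\mathbb{Q}[[x]],\qquad (u)_n=u(u+1)\cdots(u+n-1). \] A power series $f\in\mathbb{Q}[[x]]$ is called algebraic if there is a non-zero polynomial $P\in\mathbb{Q}[x,y]$ with $P(x,f(x))=0$. Then the two series \[ f_1(x)={}_2F_1\!\left(-\tfrac1{60},\tfrac{11}{60};\tfrac23;x\right)\quad\text{and}\quad f_2(x)={}_2F_1\!\left(\tfrac{19}{60},\tfrac{31}{60};\tfrac43;x\right) \] are algebraic. Moreover, there is a polynomial $P\in\mathbb{Z}[x,y]$ of degree $20$ in $y$ and degree $4$ in $x$ such that $P(x,f_1(x)^{12})=0$. -/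

import Mathlib

/-- The Gaussian hypergeometric series `₂F₁(a, b; c; x) = ∑ (a)_n (b)_n / (c)_n * x ^ n / n!`
as a formal power series over `ℚ`. Its `n`-th coefficient is Mathlib's
`ordinaryHypergeometricCoefficient a b c n`, that is `(n!)⁻¹ * (a)_n * (b)_n * ((c)_n)⁻¹`. -/
noncomputable def gaussSeries (a b c : ℚ) : PowerSeries ℚ :=
  PowerSeries.mk fun n => ordinaryHypergeometricCoefficient a b c n

/-- A power series `f ∈ ℚ⟦x⟧` is algebraic if `P(x, f(x)) = 0` for some nonzero `P ∈ ℚ[x, y]`.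
The polynomial `P` is a polynomial in `y` with coefficients in `ℚ[x]`. -/
def IsAlgebraicSeries (f : PowerSeries ℚ) : Prop :=
  ∃ P : Polynomial (Polynomial ℚ), P ≠ 0 ∧
    P.eval₂ (Polynomial.coeToPowerSeries.ringHom (R := ℚ)) f = 0

/-- The degree in the inner variable `x` of a bivariate polynomial, written as a polynomial
in `y` with coefficients that are polynomials in `x`. -/
noncomputable def degreeInX (P : Polynomial (Polynomial ℤ)) : ℕ :=
  P.support.sup fun j => (P.coeff j).natDegree

/-- The power series `P(x, f(x))`, for `P ∈ ℤ[x, y]` and `f ∈ ℚ⟦x⟧`. -/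
noncomputable def substSeries (P : Polynomial (Polynomial ℤ)) (f : PowerSeries ℚ) :
    PowerSeries ℚ :=
  P.eval₂ ((Polynomial.coeToPowerSeries.ringHom (R := ℚ)).comp
    (Polynomial.mapRingHom (Int.castRingHom ℚ))) f

/-! The exponent differences 1/3, 1/2, 1/5 at `0`, `1`, `∞` put the equation of `f₁` on Schwarz's
icosahedral list; `x ^ (1/3) * f₂` is its second solution at `0`. The equation is therefore
trivialised by Klein's covering. Modulo the rotation of order three about a face axis, this covering
is `x = ξ(z) = 8000 z s(z)³ / φ(z)⁵`, with `φ`, `s`, `e` the vertex, face and edge forms and `1 - ξ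
= e² / φ⁵`.

In the coordinate `z` the solutions are explicit: `f₁(ξ) = φ ^ (-1/12)` and `f₂(ξ) = φ ^ (19/12) /
s`. The proof measures by a series `D` how far `fᵢ(ξ)` is from satisfying the first-order equation
of the expected answer. The second-order equation makes `D` a solution of a first-order equation
with exponent `-2/3` or `-4/3` at `0`, so `D = 0` (`eq_zero_of_X_mul_derivative_eq`).

Since `ξ` has a compositional inverse `z(x)`, which is algebraic, both series are algebraic. Finally
`f₁ ^ 12 = 1 / φ(z)`, and eliminating `z` between `x`, of degree 20 in `z`, and `φ(z)`, of degree 4,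
gives the polynomial of bidegree (20, 4). -/

namespace PowerSeries

/-! ### First-order linear equations for power series -/

/-- A first-order equation `X a y' = b y` that is singular at `0` has only the trivial power series
solution unless its exponent `b(0) / a(0)` is a natural number. -/
theorem eq_zero_of_X_mul_derivative_eq {K : Type*} [Field K] {a b y : K⟦X⟧}
    (hab : ∀ n : ℕ, (n : K) * constantCoeff a ≠ constantCoeff b)
    (h : X * a * d⁄dX K y = b * y) : y = 0 := by
  by_contra hy
  set n := y.order.toNat
  set g := divXPowOrder y
  have hg : constantCoeff g ≠ 0 := fun h0 => hy (constantCoeff_divXPowOrder_eq_zero_iff.1 h0)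
  have hyg : y = X ^ n * g := X_pow_order_mul_divXPowOrder.symm
  have hX : (X : K⟦X⟧) ^ n ≠ 0 := pow_ne_zero _ X_ne_zero
  -- The factor `n` makes the truncated exponent `n - 1` harmless at `n = 0`.
  have hn : (X : K⟦X⟧) * ((n : K⟦X⟧) * X ^ (n - 1)) = (n : K⟦X⟧) * X ^ n := by
    rcases n with _ | k
    · simp
    · simp only [Nat.add_sub_cancel]; ring
  have key : a * ((n : K⟦X⟧) * g + X * d⁄dX K g) = b * g := by
    apply mul_left_cancel₀ hX
    rw [hyg, Derivation.leibniz, derivative_pow, derivative_X] at h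
    simp only [smul_eq_mul, mul_one] at h
    linear_combination h - a * g * hn
  have := congrArg constantCoeff key
  simp only [map_mul, map_add, map_natCast, constantCoeff_X, zero_mul, add_zero] at this
  apply hab n
  apply mul_right_cancel₀ hg
  linear_combination this

/-- If `f g' = n f' g`, then `g` is a constant multiple of `f ^ n`. -/
theorem eq_pow_of_mul_derivative_eq {K : Type*} [Field K] [CharZero K] {f g : K⟦X⟧} (n : ℕ)
    (hf : constantCoeff f = 1) (hg : constantCoeff g = 1)
    (h : f * d⁄dX K g = n * d⁄dX K f * g) : g = f ^ n := by
  have hf0 : constantCoeff f ≠ 0 := by simp [hf]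
  have hinv : f * f⁻¹ = 1 := PowerSeries.mul_inv_cancel f hf0
  -- The quotient `g / f ^ n` has zero derivative and constant term `1`.
  have h1 : g * f⁻¹ ^ n = 1 := by
    apply derivative.ext
    · rw [Derivation.leibniz, derivative_pow, derivative_inv', derivative_one]
      simp only [smul_eq_mul]
      rcases n with _ | k
      · have : f * d⁄dX K g = f * 0 := by simpa using h
        simpa using mul_left_cancel₀ (fun h0 => hf0 (by simp [h0])) this
      · simp only [Nat.add_sub_cancel]
        push_cast at h ⊢
        linear_combination f⁻¹ ^ (k + 2) * h - f⁻¹ ^ (k + 1) * d⁄dX K g * hinv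
    · simp [hf, hg]
  calc g = g * f⁻¹ ^ n * f ^ n := by rw [mul_assoc, ← mul_pow, mul_comm f⁻¹, hinv]; simp
    _ = f ^ n := by rw [h1, one_mul]

end PowerSeries

/-! ### The hypergeometric equation -/

open PowerSeries in
/-- The hypergeometric differential equation. -/
theorem gaussSeries_derivative (a b c : ℚ) (hc : ∀ n : ℕ, c + n ≠ 0) :
    X * (1 - X) * d⁄dX ℚ (d⁄dX ℚ (gaussSeries a b c))
      + (C c - C (a + b + 1) * X) * d⁄dX ℚ (gaussSeries a b c)
      - C (a * b) * gaussSeries a b c = 0 := by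
  have hrec : ∀ n : ℕ, ((n : ℚ) + 1) * (c + n) * coeff (n + 1) (gaussSeries a b c) =
      (a + n) * (b + n) * coeff n (gaussSeries a b c) := by
    intro n
    have h1 : (n : ℚ) + 1 ≠ 0 := by positivity
    have h2 : ((n.factorial : ℕ) : ℚ) ≠ 0 := by positivity
    have h3 := hc n
    simp only [gaussSeries, coeff_mk, ordinaryHypergeometricCoefficient, ascPochhammer_succ_eval,
      Nat.factorial_succ, Nat.cast_mul, Nat.cast_add, Nat.cast_one, mul_inv]
    field_simp
  set F := gaussSeries a b c
  -- Naming the sum keeps `C (a + b + 1)` a single constant under `map_add`.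
  obtain ⟨d, hd⟩ : ∃ d, d = a + b + 1 := ⟨_, rfl⟩
  rw [← hd]
  have e : X * (1 - X) * d⁄dX ℚ (d⁄dX ℚ F) + (C c - C d * X) * d⁄dX ℚ F - C (a * b) * F
      = X * d⁄dX ℚ (d⁄dX ℚ F) - X * (X * d⁄dX ℚ (d⁄dX ℚ F)) + C c * d⁄dX ℚ F
        - C d * (X * d⁄dX ℚ F) - C (a * b) * F := by ring
  rw [e]
  ext n
  have := hrec n
  rcases n with _ | _ | n
  · simp only [map_sub, map_add, coeff_C_mul, coeff_zero_X_mul, coeff_derivative, map_zero]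
    rw [hd]
    push_cast at *
    linear_combination this
  · simp only [map_sub, map_add, coeff_C_mul, coeff_succ_X_mul, coeff_zero_X_mul,
      coeff_derivative, map_zero]
    rw [hd]
    push_cast at *
    linear_combination this
  · simp only [map_sub, map_add, coeff_C_mul, coeff_succ_X_mul, coeff_derivative, map_zero]
    rw [hd]
    push_cast at *
    linear_combination this

theorem constantCoeff_gaussSeries (a b c : ℚ) :
    PowerSeries.constantCoeff (gaussSeries a b c) = 1 := by
  rw [← PowerSeries.coeff_zero_eq_constantCoeff_apply]
  simp [gaussSeries, ordinaryHypergeometricCoefficient]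

/-! ### Klein's icosahedral forms -/

section IcosahedralForms

variable {R S : Type*} [CommRing R] [CommRing S]

/-- The form of degree `12` vanishing at the vertices of the icosahedron, with a threefold axis
through `0` and `∞`, as a polynomial in the cube of the coordinate. -/
def vertexForm (z : R) : R :=
  1 + 440 * z - 10560 * z ^ 2 - 140800 * z ^ 3 + 102400 * z ^ 4

/-- The form of degree `20` vanishing at the face centres of the icosahedron, without its zeros
at `0` and `∞`. -/
def faceForm (z : R) : R :=
  1 - 285 * z - 9120 * z ^ 2 - 790400 * z ^ 3 + 2918400 * z ^ 4 - 29184000 * z ^ 5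
    - 32768000 * z ^ 6

/-- The form of degree `30` vanishing at the edge midpoints of the icosahedron. -/
def edgeForm (z : R) : R :=
  1 - 2900 * z + 156600 * z ^ 2 - 32016000 * z ^ 3 - 2433216000 * z ^ 4 - 778629120000 * z ^ 6
    + 3278438400000 * z ^ 7 + 5131468800000 * z ^ 8 + 30408704000000 * z ^ 9
    + 3355443200000 * z ^ 10

theorem map_vertexForm (f : R →+* S) (z : R) : f (vertexForm z) = vertexForm (f z) := by
  simp [vertexForm, map_ofNat]

theorem map_faceForm (f : R →+* S) (z : R) : f (faceForm z) = faceForm (f z) := by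
  simp [faceForm, map_ofNat]

/-- Klein's syzygy between the three icosahedral forms. -/
theorem icosahedral_syzygy (z : R) :
    vertexForm z ^ 5 - 8000 * z * faceForm z ^ 3 = edgeForm z ^ 2 := by
  simp only [vertexForm, faceForm, edgeForm]
  ring

end IcosahedralForms

/-! ### The icosahedral covering and its ramification -/

namespace PowerSeries

variable {K : Type*} [Field K]

theorem derivative_ofNat (n : ℕ) [n.AtLeastTwo] : d⁄dX K (ofNat(n) : K⟦X⟧) = 0 := by
  rw [← Nat.cast_ofNat]
  exact Derivation.map_natCast _ _

theorem derivative_vertexForm : d⁄dX K (vertexForm X) =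
    440 - 21120 * X - 422400 * X ^ 2 + 409600 * X ^ 3 := by
  simp only [vertexForm, map_add, map_sub, Derivation.leibniz, derivative_pow, derivative_X,
    derivative_ofNat, derivative_one, smul_eq_mul]
  push_cast
  ring

theorem derivative_faceForm : d⁄dX K (faceForm X) =
    -285 - 18240 * X - 2371200 * X ^ 2 + 11673600 * X ^ 3 - 145920000 * X ^ 4
      - 196608000 * X ^ 5 := by
  simp only [faceForm, map_add, map_sub, Derivation.leibniz, derivative_pow, derivative_X,
    derivative_ofNat, derivative_one, smul_eq_mul]
  push_cast
  ring

theorem derivative_edgeForm : d⁄dX K (edgeForm X) =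
    -2900 + 313200 * X - 96048000 * X ^ 2 - 9732864000 * X ^ 3 - 4671774720000 * X ^ 5
      + 22949068800000 * X ^ 6 + 41051750400000 * X ^ 7 + 273678336000000 * X ^ 8
      + 33554432000000 * X ^ 9 := by
  simp only [edgeForm, map_add, map_sub, Derivation.leibniz, derivative_pow, derivative_X,
    derivative_ofNat, derivative_one, smul_eq_mul]
  push_cast
  ring

theorem constantCoeff_vertexForm : constantCoeff (vertexForm (X : K⟦X⟧)) = 1 := by
  simp [vertexForm]

theorem constantCoeff_faceForm : constantCoeff (faceForm (X : K⟦X⟧)) = 1 := by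
  simp [faceForm]

/-- The icosahedral covering of degree `20`, centred at a fixed point of order `3`. -/
noncomputable def icosahedralMap (K : Type*) [Field K] : K⟦X⟧ :=
  8000 * X * faceForm X ^ 3 * (vertexForm X)⁻¹ ^ 5

theorem vertexForm_mul_inv : vertexForm (X : K⟦X⟧) * (vertexForm X)⁻¹ = 1 :=
  PowerSeries.mul_inv_cancel _ (by simp [constantCoeff_vertexForm])

theorem vertexForm_ne_zero : vertexForm (X : K⟦X⟧) ≠ 0 :=
  left_ne_zero_of_mul_eq_one vertexForm_mul_inv

theorem vertexForm_pow_mul_icosahedralMap :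
    vertexForm X ^ 5 * icosahedralMap K = 8000 * X * faceForm X ^ 3 := by
  have h : vertexForm (X : K⟦X⟧) ^ 5 * (vertexForm X)⁻¹ ^ 5 = 1 := by
    rw [← mul_pow, vertexForm_mul_inv, one_pow]
  rw [icosahedralMap]
  linear_combination 8000 * X * faceForm X ^ 3 * h

/-- The derivative shows the ramification: triple points at the zeros of `s`, double points at those
of `e`, poles of order five at those of `φ`. The edge form appears because it is, up to
normalisation, the Jacobian of the other two (identity `e` below). -/
theorem vertexForm_pow_mul_derivative_icosahedralMap :
    vertexForm X ^ 6 * d⁄dX K (icosahedralMap K) = 8000 * faceForm X ^ 2 * edgeForm X := by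
  have h := congrArg (d⁄dX K) (vertexForm_pow_mul_icosahedralMap (K := K))
  simp only [Derivation.leibniz, derivative_pow, derivative_X, derivative_ofNat,
    smul_eq_mul] at h
  have e : vertexForm X * (faceForm X + 3 * X * d⁄dX K (faceForm X))
      - 5 * d⁄dX K (vertexForm X) * X * faceForm X = edgeForm X := by
    rw [derivative_vertexForm, derivative_faceForm]
    simp only [vertexForm, faceForm, edgeForm]
    ring
  push_cast at h
  linear_combination vertexForm X * h
    - 5 * d⁄dX K (vertexForm X) * vertexForm_pow_mul_icosahedralMap (K := K)
    + 8000 * faceForm X ^ 2 * e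

theorem constantCoeff_icosahedralMap : constantCoeff (icosahedralMap K) = 0 := by
  simp [icosahedralMap]

theorem coeff_one_icosahedralMap : coeff 1 (icosahedralMap K) = 8000 := by
  have h : icosahedralMap K = X * (8000 * faceForm X ^ 3 * (vertexForm X)⁻¹ ^ 5) := by
    rw [icosahedralMap]; ring
  rw [h, show (1 : ℕ) = 0 + 1 from rfl, coeff_succ_X_mul, coeff_zero_eq_constantCoeff_apply]
  simp [constantCoeff_faceForm, constantCoeff_vertexForm, map_ofNat]

theorem hasSubst_icosahedralMap : HasSubst (icosahedralMap K) :=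
  HasSubst.of_constantCoeff_zero' constantCoeff_icosahedralMap

/-- The composition of a power series with constant term `y` with the icosahedral map has constant
term `y`. -/
theorem constantCoeff_subst_icosahedralMap (f : K⟦X⟧) :
    constantCoeff (f.subst (icosahedralMap K)) = constantCoeff f := by
  have h : constantCoeff ((f - C (constantCoeff f)).subst (icosahedralMap K)) = 0 :=
    constantCoeff_subst_eq_zero (R := K) (a := icosahedralMap K)
    constantCoeff_icosahedralMap (f - C (constantCoeff f)) (by simp)
  rw [subst_sub hasSubst_icosahedralMap, subst_C] at h
  rw [map_sub] at h
  exact (sub_eq_zero.1 h).trans (constantCoeff_C _)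

end PowerSeries

/-! ### Pullback of the hypergeometric equation -/

open PowerSeries in
/-- The hypergeometric equation pulled back along the icosahedral map. -/
theorem gaussSeries_derivative_subst_icosahedralMap (a b c : ℚ) (hc : ∀ n : ℕ, c + n ≠ 0) :
    icosahedralMap ℚ * (1 - icosahedralMap ℚ) *
        (d⁄dX ℚ (d⁄dX ℚ (gaussSeries a b c))).subst (icosahedralMap ℚ)
      + (C c - C (a + b + 1) * icosahedralMap ℚ) *
        (d⁄dX ℚ (gaussSeries a b c)).subst (icosahedralMap ℚ)
      - C (a * b) * (gaussSeries a b c).subst (icosahedralMap ℚ) = 0 := by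
  have hs := hasSubst_icosahedralMap (K := ℚ)
  have hC : ∀ r : ℚ, substAlgHom hs (C r) = (C r : ℚ⟦X⟧) := fun r => (substAlgHom hs).commutes r
  have h := congrArg (substAlgHom hs) (gaussSeries_derivative a b c hc)
  simp only [map_add, map_sub, map_mul, map_one, map_zero, substAlgHom_X] at h
  simp only [← map_add, ← map_mul, hC] at h
  simpa only [map_add, map_mul, map_one, coe_substAlgHom] using h

namespace PowerSeries

/-- By the syzygy, `1 - ξ = e² / φ⁵`. This clears the leading coefficient of the pulled-back
equation. -/
theorem vertexForm_pow_mul_icosahedralMap_mul_one_sub {K : Type*} [Field K] :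
    vertexForm X ^ 10 * (icosahedralMap K * (1 - icosahedralMap K)) =
      8000 * X * faceForm X ^ 3 * edgeForm X ^ 2 := by
  have h := vertexForm_pow_mul_icosahedralMap (K := K)
  linear_combination (vertexForm X ^ 5 - vertexForm X ^ 5 * icosahedralMap K
    - 8000 * X * faceForm X ^ 3) * h
    + 8000 * X * faceForm X ^ 3 * icosahedral_syzygy (X : K⟦X⟧)

theorem derivative_subst_icosahedralMap_mul {K : Type*} [Field K] (f : K⟦X⟧) :
    vertexForm X ^ 6 * d⁄dX K (f.subst (icosahedralMap K)) =
      8000 * faceForm X ^ 2 * edgeForm X * (d⁄dX K f).subst (icosahedralMap K) := by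
  rw [derivative_subst hasSubst_icosahedralMap]
  linear_combination (d⁄dX K f).subst (icosahedralMap K) *
    vertexForm_pow_mul_derivative_icosahedralMap (K := K)

end PowerSeries

/-! ### Klein's formulas for the two series -/

section KleinFormulas

open PowerSeries

/-- Klein's formula: composed with the icosahedral map, the first hypergeometric series is
`φ ^ (-1 / 12)`, where `φ` is the vertex form. -/
theorem gaussSeries_subst_icosahedralMap_pow :
    ((gaussSeries (-1 / 60) (11 / 60) (2 / 3)).subst (icosahedralMap ℚ)) ^ 12 * vertexForm X
      = 1 := by
  have hode := gaussSeries_derivative_subst_icosahedralMap (-1 / 60) (11 / 60) (2 / 3)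
    (fun n => by positivity)
  have hd := derivative_subst_icosahedralMap_mul (gaussSeries (-1 / 60) (11 / 60) (2 / 3))
  have hd' := derivative_subst_icosahedralMap_mul
    (d⁄dX ℚ (gaussSeries (-1 / 60) (11 / 60) (2 / 3)))
  have h0 : constantCoeff
      ((gaussSeries (-1 / 60) (11 / 60) (2 / 3)).subst (icosahedralMap ℚ)) = 1 := by
    rw [constantCoeff_subst_icosahedralMap, constantCoeff_gaussSeries]
  have hξ := vertexForm_pow_mul_icosahedralMap (K := ℚ)
  have hξ' := vertexForm_pow_mul_icosahedralMap_mul_one_sub (K := ℚ)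
  generalize (gaussSeries (-1 / 60) (11 / 60) (2 / 3)).subst (icosahedralMap ℚ) = h at *
  generalize (d⁄dX ℚ (gaussSeries (-1 / 60) (11 / 60) (2 / 3))).subst (icosahedralMap ℚ) = g at *
  generalize (d⁄dX ℚ (d⁄dX ℚ (gaussSeries (-1 / 60) (11 / 60) (2 / 3)))).subst
    (icosahedralMap ℚ) = k at *
  -- The factor `3600 = 60²` clears the denominators of the parameters.
  have hode' : 3600 * (icosahedralMap ℚ * (1 - icosahedralMap ℚ) * k)
      + (2400 - 4200 * icosahedralMap ℚ) * g + 11 * h = 0 := by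
    have h1 : (3600 : ℚ⟦X⟧) * C (2 / 3) = 2400 := by
      rw [← map_ofNat C, ← map_mul, ← map_ofNat C]; norm_num
    have h2 : (3600 : ℚ⟦X⟧) * C (-1 / 60 + 11 / 60 + 1) = 4200 := by
      rw [← map_ofNat C, ← map_mul, ← map_ofNat C]; norm_num
    have h3 : (3600 : ℚ⟦X⟧) * C (-1 / 60 * (11 / 60)) = -11 := by
      rw [← map_ofNat C, ← map_mul, ← map_ofNat C, ← map_neg]; norm_num
    linear_combination 3600 * hode - g * h1 + icosahedralMap ℚ * g * h2 + h * h3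
  -- `hG` and `hH` compare the coefficients of `g` and `h` in the equation for `D` below: both yield
  -- the same quartic factor, which expresses that `φ ^ (-1/12)` solves the pulled-back equation.
  have hG : 3 * (X * vertexForm X * 96000 * (2 * d⁄dX ℚ (faceForm X) * edgeForm X
        + faceForm X * d⁄dX ℚ (edgeForm X))
        + 8000 * X * faceForm X * edgeForm X * d⁄dX ℚ (vertexForm X))
      - 80 * (2400 * vertexForm X ^ 5 - 4200 * 8000 * X * faceForm X ^ 3) =
      96000 * (-2 + 6930 * X - 353760 * X ^ 2 - 7216000 * X ^ 3 + 7065600 * X ^ 4)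
        * faceForm X * edgeForm X := by
    rw [derivative_vertexForm, derivative_faceForm, derivative_edgeForm]
    simp only [vertexForm, faceForm, edgeForm]
    ring
  have hH : 3 * X * (5 * d⁄dX ℚ (vertexForm X) ^ 2
        + vertexForm X * d⁄dX ℚ (d⁄dX ℚ (vertexForm X))) - 880 * faceForm X =
      (-2 + 6930 * X - 353760 * X ^ 2 - 7216000 * X ^ 3 + 7065600 * X ^ 4)
        * d⁄dX ℚ (vertexForm X) := by
    rw [derivative_vertexForm]
    simp only [map_add, map_sub, Derivation.leibniz, derivative_pow, derivative_X,
      derivative_ofNat, smul_eq_mul]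
    simp only [vertexForm, faceForm]
    push_cast
    ring
  -- By `hd` the left side is `φ⁵ (12 φ h' + φ' h)`, the defect of `h` from `φ ^ (-1/12)`. Its
  -- equation has exponent `-2/3` at `0`, so it vanishes.
  have hD : 96000 * faceForm X ^ 2 * edgeForm X * g
      + vertexForm X ^ 5 * d⁄dX ℚ (vertexForm X) * h = 0 := by
    refine eq_zero_of_X_mul_derivative_eq (a := 3 * vertexForm X)
      (b := -2 + 6930 * X - 353760 * X ^ 2 - 7216000 * X ^ 3 + 7065600 * X ^ 4)
      (fun n hn => ?_) ?_
    · simp only [map_add, map_sub, map_mul, map_neg, map_pow, map_ofNat, constantCoeff_X,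
        constantCoeff_vertexForm] at hn
      have : (0 : ℚ) ≤ n := n.cast_nonneg
      norm_num at hn
      linarith
    · apply mul_left_cancel₀ (pow_ne_zero 5 (vertexForm_ne_zero (K := ℚ)))
      simp only [map_add, Derivation.leibniz, derivative_pow, derivative_ofNat, smul_eq_mul]
      push_cast
      -- `hd'` replaces `g'` by `k`, then `hξ'` and `hode'` eliminate `k`, leaving only terms in `g`
      -- and `h`.
      linear_combination 288000 * X * faceForm X ^ 2 * edgeForm X * hd'
        + 3 * X * vertexForm X ^ 5 * d⁄dX ℚ (vertexForm X) * hd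
        - 288000 * faceForm X * k * hξ'
        + 80 * faceForm X * vertexForm X ^ 10 * hode'
        + 80 * 4200 * faceForm X * vertexForm X ^ 5 * g * hξ
        + vertexForm X ^ 5 * faceForm X * g * hG
        + vertexForm X ^ 10 * h * hH
  have hlog : 12 * vertexForm X * d⁄dX ℚ h + d⁄dX ℚ (vertexForm X) * h = 0 := by
    apply mul_left_cancel₀ (pow_ne_zero 5 (vertexForm_ne_zero (K := ℚ)))
    linear_combination hD + 12 * hd
  apply derivative.ext
  · simp only [Derivation.leibniz, derivative_pow, derivative_one, smul_eq_mul]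
    push_cast
    linear_combination h ^ 11 * hlog
  · simp [h0, constantCoeff_vertexForm]

/-- Klein's formula for the second hypergeometric series. -/
theorem gaussSeries_subst_icosahedralMap_mul_faceForm_pow :
    ((gaussSeries (19 / 60) (31 / 60) (4 / 3)).subst (icosahedralMap ℚ) * faceForm X) ^ 12
      = vertexForm X ^ 19 := by
  have hode := gaussSeries_derivative_subst_icosahedralMap (19 / 60) (31 / 60) (4 / 3)
    (fun n => by positivity)
  have hd := derivative_subst_icosahedralMap_mul (gaussSeries (19 / 60) (31 / 60) (4 / 3))
  have hd' := derivative_subst_icosahedralMap_mul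
    (d⁄dX ℚ (gaussSeries (19 / 60) (31 / 60) (4 / 3)))
  have h0 : constantCoeff
      ((gaussSeries (19 / 60) (31 / 60) (4 / 3)).subst (icosahedralMap ℚ)) = 1 := by
    rw [constantCoeff_subst_icosahedralMap, constantCoeff_gaussSeries]
  have hξ := vertexForm_pow_mul_icosahedralMap (K := ℚ)
  have hξ' := vertexForm_pow_mul_icosahedralMap_mul_one_sub (K := ℚ)
  generalize (gaussSeries (19 / 60) (31 / 60) (4 / 3)).subst (icosahedralMap ℚ) = h at *
  generalize (d⁄dX ℚ (gaussSeries (19 / 60) (31 / 60) (4 / 3))).subst (icosahedralMap ℚ) = g at *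
  generalize (d⁄dX ℚ (d⁄dX ℚ (gaussSeries (19 / 60) (31 / 60) (4 / 3)))).subst
    (icosahedralMap ℚ) = k at *
  have hode' : 3600 * (icosahedralMap ℚ * (1 - icosahedralMap ℚ) * k)
      + (4800 - 6600 * icosahedralMap ℚ) * g - 589 * h = 0 := by
    have h1 : (3600 : ℚ⟦X⟧) * C (4 / 3) = 4800 := by
      rw [← map_ofNat C, ← map_mul, ← map_ofNat C]; norm_num
    have h2 : (3600 : ℚ⟦X⟧) * C (19 / 60 + 31 / 60 + 1) = 6600 := by
      rw [← map_ofNat C, ← map_mul, ← map_ofNat C]; norm_num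
    have h3 : (3600 : ℚ⟦X⟧) * C (19 / 60 * (31 / 60)) = 589 := by
      rw [← map_ofNat C, ← map_mul, ← map_ofNat C]; norm_num
    linear_combination 3600 * hode - g * h1 + icosahedralMap ℚ * g * h2 + h * h3
  have hG : 3 * (X * vertexForm X * 96000 * (3 * d⁄dX ℚ (faceForm X) * edgeForm X
        + faceForm X * d⁄dX ℚ (edgeForm X))
        + 8000 * X * edgeForm X * (12 * vertexForm X * d⁄dX ℚ (faceForm X)
          - 19 * d⁄dX ℚ (vertexForm X) * faceForm X))
      - 80 * (4800 * vertexForm X ^ 5 - 6600 * 8000 * X * faceForm X ^ 3) =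
      96000 * (-4 + 8250 * X - 438240 * X ^ 2 - 9046400 * X ^ 3 + 8908800 * X ^ 4)
        * faceForm X * edgeForm X := by
    rw [derivative_vertexForm, derivative_faceForm, derivative_edgeForm]
    simp only [vertexForm, faceForm, edgeForm]
    ring
  have hH : 3 * X * (5 * d⁄dX ℚ (vertexForm X) * (12 * vertexForm X * d⁄dX ℚ (faceForm X)
          - 19 * d⁄dX ℚ (vertexForm X) * faceForm X)
        + vertexForm X * (12 * vertexForm X * d⁄dX ℚ (d⁄dX ℚ (faceForm X))
          - 7 * d⁄dX ℚ (vertexForm X) * d⁄dX ℚ (faceForm X)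
          - 19 * d⁄dX ℚ (d⁄dX ℚ (vertexForm X)) * faceForm X)) + 80 * 589 * faceForm X ^ 2 =
      (-4 + 8250 * X - 438240 * X ^ 2 - 9046400 * X ^ 3 + 8908800 * X ^ 4)
        * (12 * vertexForm X * d⁄dX ℚ (faceForm X)
          - 19 * d⁄dX ℚ (vertexForm X) * faceForm X) := by
    rw [derivative_vertexForm, derivative_faceForm]
    simp only [map_add, map_sub, map_neg, Derivation.leibniz, derivative_pow, derivative_X,
      derivative_ofNat, smul_eq_mul]
    simp only [vertexForm, faceForm]
    push_cast
    ring
  -- The same argument for the defect `φ⁵ (12 φ s h' + (12 φ s' - 19 φ' s) h)` from `φ ^ (19/12) /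
  -- s`; the exponent is now `-4/3`.
  have hD : 96000 * faceForm X ^ 3 * edgeForm X * g
      + vertexForm X ^ 5 * (12 * vertexForm X * d⁄dX ℚ (faceForm X)
          - 19 * d⁄dX ℚ (vertexForm X) * faceForm X) * h = 0 := by
    refine eq_zero_of_X_mul_derivative_eq (a := 3 * vertexForm X)
      (b := -4 + 8250 * X - 438240 * X ^ 2 - 9046400 * X ^ 3 + 8908800 * X ^ 4)
      (fun n hn => ?_) ?_
    · simp only [map_add, map_sub, map_mul, map_neg, map_pow, map_ofNat, constantCoeff_X,
        constantCoeff_vertexForm] at hn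
      have : (0 : ℚ) ≤ n := n.cast_nonneg
      norm_num at hn
      linarith
    · apply mul_left_cancel₀ (pow_ne_zero 5 (vertexForm_ne_zero (K := ℚ)))
      simp only [map_add, map_sub, Derivation.leibniz, derivative_pow, derivative_ofNat,
        smul_eq_mul]
      push_cast
      linear_combination 288000 * X * faceForm X ^ 3 * edgeForm X * hd'
        + 3 * X * vertexForm X ^ 5 * (12 * vertexForm X * d⁄dX ℚ (faceForm X)
          - 19 * d⁄dX ℚ (vertexForm X) * faceForm X) * hd
        - 288000 * faceForm X ^ 2 * k * hξ'
        + 80 * faceForm X ^ 2 * vertexForm X ^ 10 * hode'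
        + 80 * 6600 * faceForm X ^ 2 * vertexForm X ^ 5 * g * hξ
        + vertexForm X ^ 5 * faceForm X ^ 2 * g * hG
        + vertexForm X ^ 10 * h * hH
  have hlog : 12 * vertexForm X * faceForm X * d⁄dX ℚ h
      + (12 * vertexForm X * d⁄dX ℚ (faceForm X)
          - 19 * d⁄dX ℚ (vertexForm X) * faceForm X) * h = 0 := by
    apply mul_left_cancel₀ (pow_ne_zero 5 (vertexForm_ne_zero (K := ℚ)))
    linear_combination hD + 12 * faceForm X * hd
  apply eq_pow_of_mul_derivative_eq
  · exact constantCoeff_vertexForm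
  · simp [h0, constantCoeff_faceForm]
  · simp only [Derivation.leibniz, derivative_pow, smul_eq_mul]
    push_cast
    linear_combination (h * faceForm X) ^ 11 * hlog

end KleinFormulas

/-! ### Elimination of the icosahedral parameter -/

section KleinPolynomial

variable {R S : Type*} [CommRing R] [CommRing S]

/-- The coefficient of `x ^ 0` in the polynomial relation between the icosahedral map `x` and
the reciprocal `y` of the vertex form. -/
def kleinCoeffZero (y : R) : R :=
  -671088640000000000 * y + 475523520102400000000000 * y ^ 2 - 113007061873429497720000000000 *
    y ^ 3 + 9169406385536820289950177978515625 * y ^ 4 - 38891323391263184788962380281406250000 *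
    y ^ 5 + 70215901744588256114185368437020546875000 * y ^ 6 -
    68025485746110415191793793613578917968750000 * y ^ 7 +
    37211030009314178328489649728907781622773437500 * y ^ 8 -
    10915403773410112125257639617630209791041406250000 * y ^ 9 +
    1360780780405250731505740348296455133910015078125000 * y ^ 10 -
    9516618362437158537121416594390181450816946718750000 * y ^ 11 +
    527986215341813262800978341893223548183847630371093750 * y ^ 12 -
    3232281074090433790549185655249880228430335010468750000 * y ^ 13 +
    71565277708099304843858474137828998799269857586328125000 * y ^ 14 -
    453316684238263918088930933991802213106850480995156250000 * y ^ 15 +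
    3838937213347552774748737391744509287670558908151523437500 * y ^ 16 -
    22647476697069360278785650915794671449383943234986718750000 * y ^ 17 +
    62270309991917237124101583899372243877956897558436796875000 * y ^ 18 -
    76098712045586048098352463691955016047420563795460156250000 * y ^ 19 +
    33021405405495374442677944066330480177719994646958603515625 * y ^ 20

/-- The coefficient of `x ^ 1` in the polynomial relation between the icosahedral map `x` and
the reciprocal `y` of the vertex form. -/
def kleinCoeffOne (y : R) : R :=
  988178022400000000 * y + 6225565983075532800000000 * y ^ 2 + 1051466441807918621785500000000 *
    y ^ 3 - 12250784325861264717713264400000000 * y ^ 4 + 72932673283910206642148932812600000000 *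
    y ^ 5 - 118804735007054742194437816274101200000000 * y ^ 6 +
    71863359009625728268211889388239358500000000 * y ^ 7 -
    13507348254484461968728638670388896864800000000 * y ^ 8 +
    217052663804935308183199975964904279920400000000 * y ^ 9 -
    526869016342848451610352618143034797963834400000000 * y ^ 10 -
    24726961516454589653996146982664962034226283100000000 * y ^ 11 +
    292477005890336898041384904418263497142488785200000000 * y ^ 12 +
    12932477136517955037698314110429083378327326630200000000 * y ^ 13 -
    165009938123463970782317168125377537399652293853200000000 * y ^ 14 +
    481834398760883810270555776076915029151179870153500000000 * y ^ 15

/-- The coefficient of `x ^ 2` in the polynomial relation between the icosahedral map `x` and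
the reciprocal `y` of the vertex form. -/
def kleinCoeffTwo (y : R) : R :=
  -365317062656000000 * y + 2500182097714094976000000 * y ^ 2 - 649005858010131141182054400000 *
    y ^ 3 + 7013151254500753617665487360000000 * y ^ 4 - 15532962803270696432654629600665600000 *
    y ^ 5 + 217075532529813770687991832105493760000000 * y ^ 6 +
    194730981995841831491976212019206077440000000 * y ^ 7 +
    33041972989113523115796847080097128770457600000 * y ^ 8 +
    1772173097436525087199920999529225754428416000000 * y ^ 9 +
    29349389326287022284343403307379473637284326400000 * y ^ 10

/-- The coefficient of `x ^ 3` in the polynomial relation between the icosahedral map `x` and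
the reciprocal `y` of the vertex form. -/
def kleinCoeffThree (y : R) : R :=
  23331114713088000 * y + 34646342610643845120000 * y ^ 2 + 9225320421149533984260096000 * y ^ 3
    + 777542567732376833395152912384000 * y ^ 4 + 20206326565010606386122125399162880000 * y ^ 5

theorem map_kleinCoeffZero (f : R →+* S) (y : R) :
    f (kleinCoeffZero y) = kleinCoeffZero (f y) := by
  simp [kleinCoeffZero, map_ofNat]

theorem map_kleinCoeffOne (f : R →+* S) (y : R) : f (kleinCoeffOne y) = kleinCoeffOne (f y) := by
  simp [kleinCoeffOne, map_ofNat]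

theorem map_kleinCoeffTwo (f : R →+* S) (y : R) : f (kleinCoeffTwo y) = kleinCoeffTwo (f y) := by
  simp [kleinCoeffTwo, map_ofNat]

theorem map_kleinCoeffThree (f : R →+* S) (y : R) :
    f (kleinCoeffThree y) = kleinCoeffThree (f y) := by
  simp [kleinCoeffThree, map_ofNat]

/-! ### Integer polynomials as coefficient lists -/

section DenseIntegerPolynomials

/-- Evaluation of a polynomial given by its list of integer coefficients, lowest degree first. -/
def listEval (z : R) : List ℤ → R
  | [] => 0
  | c :: l => c + z * listEval z l

/-- Addition of coefficient lists. -/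
def listAdd : List ℤ → List ℤ → List ℤ
  | [], m => m
  | a :: l, [] => a :: l
  | a :: l, b :: m => (a + b) :: listAdd l m

/-- Multiplication of coefficient lists. -/
def listMul : List ℤ → List ℤ → List ℤ
  | [], _ => []
  | a :: l, m => listAdd (m.map (a * ·)) (0 :: listMul l m)

/-- Composition of coefficient lists. -/
def listComp (q : List ℤ) : List ℤ → List ℤ
  | [] => []
  | c :: l => listAdd [c] (listMul q (listComp q l))

theorem listEval_add (z : R) (l m : List ℤ) :
    listEval z (listAdd l m) = listEval z l + listEval z m := by
  induction l generalizing m with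
  | nil => simp [listAdd, listEval]
  | cons a l ih =>
    cases m with
    | nil => simp [listAdd, listEval]
    | cons b m => simp only [listAdd, listEval, ih]; push_cast; ring

theorem listEval_map_mul (z : R) (a : ℤ) (l : List ℤ) :
    listEval z (l.map (a * ·)) = a * listEval z l := by
  induction l with
  | nil => simp [listEval]
  | cons b l ih => simp only [List.map_cons, listEval, ih]; push_cast; ring

theorem listEval_mul (z : R) (l m : List ℤ) :
    listEval z (listMul l m) = listEval z l * listEval z m := by
  induction l with
  | nil => simp [listMul, listEval]
  | cons a l ih =>
    simp only [listMul, listEval_add, listEval_map_mul, listEval, ih]; push_cast; ring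

theorem listEval_comp (z : R) (q l : List ℤ) :
    listEval z (listComp q l) = listEval (listEval z q) l := by
  induction l with
  | nil => simp [listComp, listEval]
  | cons c l ih => simp [listComp, listEval_add, listEval_mul, listEval, ih]

theorem listEval_eq_zero (z : R) (l : List ℤ) (h : l.all (· == 0) = true) : listEval z l = 0 := by
  induction l with
  | nil => rfl
  | cons c l ih =>
    simp only [List.all_cons, Bool.and_eq_true, beq_iff_eq] at h
    simp [listEval, h.1, ih h.2]

end DenseIntegerPolynomials

/-- The characteristic equation of `w = z s(z) ^ 3` over the subring generated by `q = φ(z)`, for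
the vertex form `φ` and the face form `s`; the entries are the coefficients of `1, w, w ^ 2, w ^ 3`
and `w ^ 4`, as polynomials in `q`. -/
def vertexFaceRelation : List (List ℤ) :=
  [[33021405405495374442677944066330480177719994646958603515625,
    -76098712045586048098352463691955016047420563795460156250000,
    62270309991917237124101583899372243877956897558436796875000,
    -22647476697069360278785650915794671449383943234986718750000,
    3838937213347552774748737391744509287670558908151523437500,
    -453316684238263918088930933991802213106850480995156250000,
    71565277708099304843858474137828998799269857586328125000,
    -3232281074090433790549185655249880228430335010468750000,
    527986215341813262800978341893223548183847630371093750,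
    -9516618362437158537121416594390181450816946718750000,
    1360780780405250731505740348296455133910015078125000,
    -10915403773410112125257639617630209791041406250000,
    37211030009314178328489649728907781622773437500,
    -68025485746110415191793793613578917968750000, 70215901744588256114185368437020546875000,
    -38891323391263184788962380281406250000, 9169406385536820289950177978515625,
    -113007061873429497720000000000, 475523520102400000000000, -671088640000000000],
   [3854675190087070482164446208615320233209438961228000000000000,
    -1320079504987711766258537345003020299197218350825600000000000,
    103459817092143640301586512883432667026618613041600000000000,
    2339816047122695184331079235346107977139910281600000000000,
    -197815692131636717231969175861319696273810264800000000000,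
    -4214952130742787612882820945144278383710675200000000000,
    1736421310439482465465599807719234239363200000000000,
    -108058786035875695749829109363111174918400000000000,
    574906872077005826145695115105914868000000000000,
    -950437880056437937555502530192809600000000000, 583461386271281653137191462500800000000000,
    -98006274606890117741706115200000000000, 8411731534463348974284000000000000,
    49804527864604262400000000000, 7905424179200000000000],
   [1878360916882369426197977811672286312786196889600000000000,
    113419078235937605580794943969870448283418624000000000000,
    2114686271303265479410998213126216241309286400000000000,
    12462782847733877215486477569229188956160000000000000,
    13892834081908081324031477254751600640000000000000,
    -994109619409324571689896294442598400000000000, 448841680288048231530591191040000000000000,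
    -41536374912648393035651481600000000000, 160011654253702078464000000000000,
    -23380292009984000000000000],
   [10345639201285430469694528204371394560000000000000,
    398101794678976938698318291140608000000000000, 4723364055628561399941169152000000000000,
    17738927416649648701440000000000000, 11945530733101056000000000000],
   [68719476736000000000000]]

/-- An identity of degree 76 in `z` with very large coefficients. It is transported to coefficient
lists, where it becomes a finite computation with integers. -/
theorem vertexForm_faceForm_relation (z : R) :
    vertexFaceRelation.foldr (fun r y => listEval (vertexForm z) r + z * faceForm z ^ 3 * y) 0
      = 0 := by
  have hq : listEval z [1, 440, -10560, -140800, 102400] = vertexForm z := by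
    simp only [listEval, vertexForm]; push_cast; ring
  have hs : listEval z [1, -285, -9120, -790400, 2918400, -29184000, -32768000] = faceForm z := by
    simp only [listEval, faceForm]; push_cast; ring
  have hw : listEval z (0 :: listMul [1, -285, -9120, -790400, 2918400, -29184000, -32768000]
      (listMul [1, -285, -9120, -790400, 2918400, -29184000, -32768000]
        [1, -285, -9120, -790400, 2918400, -29184000, -32768000])) = z * faceForm z ^ 3 := by
    simp only [← hs, listEval, listEval_mul]; push_cast; ring
  have hfold : ∀ L : List (List ℤ), listEval z (L.foldr (fun r y =>
      listAdd (listComp [1, 440, -10560, -140800, 102400] r)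
        (listMul (0 :: listMul [1, -285, -9120, -790400, 2918400, -29184000, -32768000]
          (listMul [1, -285, -9120, -790400, 2918400, -29184000, -32768000]
            [1, -285, -9120, -790400, 2918400, -29184000, -32768000])) y)) [])
      = L.foldr (fun r y => listEval (vertexForm z) r + z * faceForm z ^ 3 * y) 0 := by
    intro L
    induction L with
    | nil => rfl
    | cons r L ih =>
      rw [List.foldr_cons, List.foldr_cons, listEval_add, listEval_comp, hq, listEval_mul, hw, ih]
  rw [← hfold]
  -- The lists are never trimmed, so the result is a list of zeros rather than the empty list.
  exact listEval_eq_zero z _ (by decide +kernel)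

/-- Substitute `w = x q⁵ / 8000` in the relation between `q = φ(z)` and `w = z s(z)³`, and divide by
`q ^ 20`. The coefficient of `x ^ j` is thus the `j`-th entry of `vertexFaceRelation`, reversed and
divided by `8000 ^ j`. -/
theorem kleinCoeff_relation {x u z : R} (hx : vertexForm z ^ 5 * x = 8000 * z * faceForm z ^ 3)
    (hu : u * vertexForm z = 1) :
    kleinCoeffZero u + kleinCoeffOne u * x + kleinCoeffTwo u * x ^ 2 + kleinCoeffThree u * x ^ 3
      + 16777216 * x ^ 4 = 0 := by
  have h := vertexForm_faceForm_relation z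
  simp only [vertexFaceRelation, List.foldr_cons, List.foldr_nil, listEval] at h
  push_cast at h
  generalize vertexForm z = q at *
  have hxw : x = 8000 * (z * faceForm z ^ 3) * u ^ 5 := by
    have h5 : u ^ 5 * q ^ 5 = 1 := by rw [← mul_pow, hu, one_pow]
    linear_combination u ^ 5 * hx - x * h5
  generalize z * faceForm z ^ 3 = w at *
  have hk : ∀ k l : ℕ, k + l = 20 → u ^ k = u ^ 20 * q ^ l := by
    intro k l hkl
    rw [← hkl, pow_add, mul_assoc, ← mul_pow, hu, one_pow, mul_one]
  rw [hxw]
  simp only [kleinCoeffZero, kleinCoeffOne, kleinCoeffTwo, kleinCoeffThree]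
  -- The multiplier of `hk k l` is the coefficient of `q ^ l` in the relation, read as a polynomial
  -- in `q` over `ℤ[w]`.
  linear_combination u ^ 20 * h
    + (-671088640000000000) * hk 1 19 rfl
    + (475523520102400000000000) * hk 2 18 rfl
    + (-113007061873429497720000000000) * hk 3 17 rfl
    + (9169406385536820289950177978515625) * hk 4 16 rfl
    + (-38891323391263184788962380281406250000) * hk 5 15 rfl
    + (70215901744588256114185368437020546875000 + 7905424179200000000000 * w) * hk 6 14 rfl
    + (-68025485746110415191793793613578917968750000 + 49804527864604262400000000000 * w)
      * hk 7 13 rfl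
    + (37211030009314178328489649728907781622773437500 + 8411731534463348974284000000000000 * w)
      * hk 8 12 rfl
    + (-10915403773410112125257639617630209791041406250000 - 98006274606890117741706115200000000000 * w)
      * hk 9 11 rfl
    + (1360780780405250731505740348296455133910015078125000 + 583461386271281653137191462500800000000000 * w)
      * hk 10 10 rfl
    + (-9516618362437158537121416594390181450816946718750000 - 950437880056437937555502530192809600000000000 * w - 23380292009984000000000000 * w ^ 2)
      * hk 11 9 rfl
    + (527986215341813262800978341893223548183847630371093750 + 574906872077005826145695115105914868000000000000 * w + 160011654253702078464000000000000 * w ^ 2)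
      * hk 12 8 rfl
    + (-3232281074090433790549185655249880228430335010468750000 - 108058786035875695749829109363111174918400000000000 * w - 41536374912648393035651481600000000000 * w ^ 2)
      * hk 13 7 rfl
    + (71565277708099304843858474137828998799269857586328125000 + 1736421310439482465465599807719234239363200000000000 * w + 448841680288048231530591191040000000000000 * w ^ 2)
      * hk 14 6 rfl
    + (-453316684238263918088930933991802213106850480995156250000 - 4214952130742787612882820945144278383710675200000000000 * w - 994109619409324571689896294442598400000000000 * w ^ 2)
      * hk 15 5 rfl
    + (3838937213347552774748737391744509287670558908151523437500 - 197815692131636717231969175861319696273810264800000000000 * w + 13892834081908081324031477254751600640000000000000 * w ^ 2 + 11945530733101056000000000000 * w ^ 3)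
      * hk 16 4 rfl
    + (-22647476697069360278785650915794671449383943234986718750000 + 2339816047122695184331079235346107977139910281600000000000 * w + 12462782847733877215486477569229188956160000000000000 * w ^ 2 + 17738927416649648701440000000000000 * w ^ 3)
      * hk 17 3 rfl
    + (62270309991917237124101583899372243877956897558436796875000 + 103459817092143640301586512883432667026618613041600000000000 * w + 2114686271303265479410998213126216241309286400000000000 * w ^ 2 + 4723364055628561399941169152000000000000 * w ^ 3)
      * hk 18 2 rfl
    + (-76098712045586048098352463691955016047420563795460156250000 - 1320079504987711766258537345003020299197218350825600000000000 * w + 113419078235937605580794943969870448283418624000000000000 * w ^ 2 + 398101794678976938698318291140608000000000000 * w ^ 3)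
      * hk 19 1 rfl

end KleinPolynomial

/-! ### Inversion of the covering -/

open PowerSeries in
/-- Klein's parametrization of both hypergeometric series by the inverse of the icosahedral map. -/
theorem exists_icosahedral_parameter : ∃ z : ℚ⟦X⟧,
    vertexForm z ^ 5 * X = 8000 * z * faceForm z ^ 3 ∧
    gaussSeries (-1 / 60) (11 / 60) (2 / 3) ^ 12 * vertexForm z = 1 ∧
    (gaussSeries (19 / 60) (31 / 60) (4 / 3) * faceForm z) ^ 12 = vertexForm z ^ 19 := by
  have hu : IsUnit (coeff 1 (icosahedralMap ℚ)) := by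
    rw [coeff_one_icosahedralMap]
    norm_num
  have hZ : HasSubst (substInvOfIsUnit (icosahedralMap ℚ) hu) := HasSubst.substInvOfIsUnit _ _
  -- `τ` is composition with the inverse of `ξ`; it undoes substitution of `ξ` and carries Klein's
  -- formulas back to the variable `x`.
  obtain ⟨τ, hτ⟩ : ∃ τ : ℚ⟦X⟧ →ₐ[ℚ] ℚ⟦X⟧,
      ∀ f, τ f = f.subst (substInvOfIsUnit (icosahedralMap ℚ) hu) :=
    ⟨substAlgHom hZ, fun f => by rw [coe_substAlgHom]⟩
  have hinv : τ (icosahedralMap ℚ) = X := by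
    rw [hτ, subst_substInvOfIsUnit_right _ constantCoeff_icosahedralMap hu]
  have hcomp : ∀ f : ℚ⟦X⟧, τ (f.subst (icosahedralMap ℚ)) = f := fun f => by
    rw [hτ, subst_comp_subst_apply hasSubst_icosahedralMap hZ,
      subst_substInvOfIsUnit_right _ constantCoeff_icosahedralMap hu, X_subst]
  have hv : τ (vertexForm X) = vertexForm (τ X) := map_vertexForm τ.toRingHom X
  have hf : τ (faceForm X) = faceForm (τ X) := map_faceForm τ.toRingHom X
  refine ⟨τ X, ?_, ?_, ?_⟩
  · have h := congrArg τ (vertexForm_pow_mul_icosahedralMap (K := ℚ))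
    simpa only [map_mul, map_pow, map_ofNat, hinv, hv, hf] using h
  · have h := congrArg τ gaussSeries_subst_icosahedralMap_pow
    simpa only [map_mul, map_pow, map_one, hcomp, hv] using h
  · have h := congrArg τ gaussSeries_subst_icosahedralMap_mul_faceForm_pow
    simpa only [map_mul, map_pow, hcomp, hv, hf] using h

/-! ### Algebraicity and the degrees of the polynomial -/

section Algebraic

open Polynomial

/-- Algebraic elements form a subalgebra, inside which the form can be evaluated. -/
theorem IsAlgebraic.vertexForm {R A : Type*} [CommRing R] [IsDomain R] [CommRing A] [Algebra R A]
    {a : A} (ha : IsAlgebraic R a) : IsAlgebraic R (vertexForm a) := by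
  have h := map_vertexForm (Subalgebra.algebraicClosure R A).val.toRingHom ⟨a, ha⟩
  exact h ▸ (_root_.vertexForm (⟨a, ha⟩ : Subalgebra.algebraicClosure R A)).2

theorem IsAlgebraic.faceForm {R A : Type*} [CommRing R] [IsDomain R] [CommRing A] [Algebra R A]
    {a : A} (ha : IsAlgebraic R a) : IsAlgebraic R (faceForm a) := by
  have h := map_faceForm (Subalgebra.algebraicClosure R A).val.toRingHom ⟨a, ha⟩
  exact h ▸ (_root_.faceForm (⟨a, ha⟩ : Subalgebra.algebraicClosure R A)).2

theorem isAlgebraicSeries_of_isAlgebraic {f : PowerSeries ℚ} (hf : IsAlgebraic ℚ[X] f) :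
    IsAlgebraicSeries f := by
  obtain ⟨P, hP, h⟩ := hf
  exact ⟨P, hP, h⟩

theorem isAlgebraic_of_icosahedral_parameter {z : PowerSeries ℚ}
    (hz : vertexForm z ^ 5 * PowerSeries.X = 8000 * z * faceForm z ^ 3) :
    IsAlgebraic ℚ[X] z := by
  refine ⟨vertexForm (X : Polynomial ℚ[X]) ^ 5 * C X - 8000 * X * faceForm X ^ 3, fun h => ?_, ?_⟩
  -- At `z = 0` the polynomial takes the value `x`, because `φ(0) = 1`.
  · have := congrArg (eval 0) h
    simp [vertexForm] at this
  · have hv : aeval z (vertexForm (X : Polynomial ℚ[X])) = vertexForm z := by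
      simpa using map_vertexForm (aeval (R := ℚ[X]) z).toRingHom X
    have hf : aeval z (faceForm (X : Polynomial ℚ[X])) = faceForm z := by
      simpa using map_faceForm (aeval (R := ℚ[X]) z).toRingHom X
    have hX : algebraMap ℚ[X] (PowerSeries ℚ) X = PowerSeries.X := coe_X
    simp only [map_sub, map_mul, map_pow, map_ofNat, aeval_X, aeval_C, hv, hf, hX, hz, sub_self]

/-- The polynomial relation, of degree `20` in `y` and `4` in `x`, between the icosahedral map `x`
and the reciprocal `y` of the vertex form. -/
noncomputable def kleinPolynomial : Polynomial ℤ[X] :=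
  kleinCoeffZero (X : Polynomial ℤ[X]) + kleinCoeffOne (X : Polynomial ℤ[X]) * C X
    + kleinCoeffTwo (X : Polynomial ℤ[X]) * C (X ^ 2)
    + kleinCoeffThree (X : Polynomial ℤ[X]) * C (X ^ 3) + C (16777216 * X ^ 4)

theorem substSeries_kleinPolynomial {f z : PowerSeries ℚ}
    (hz : vertexForm z ^ 5 * PowerSeries.X = 8000 * z * faceForm z ^ 3)
    (hf : f * vertexForm z = 1) : substSeries kleinPolynomial f = 0 := by
  rw [substSeries, ← coe_eval₂RingHom, kleinPolynomial]
  simp only [map_add, map_mul, map_kleinCoeffZero, map_kleinCoeffOne,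
    map_kleinCoeffTwo, map_kleinCoeffThree, coe_eval₂RingHom, eval₂_X, eval₂_C]
  simpa [map_ofNat] using kleinCoeff_relation hz hf

theorem coeff_kleinPolynomial (j : ℕ) : kleinPolynomial.coeff j =
    C ((kleinCoeffZero (X : ℤ[X])).coeff j) + C ((kleinCoeffOne (X : ℤ[X])).coeff j) * X
      + C ((kleinCoeffTwo (X : ℤ[X])).coeff j) * X ^ 2
      + C ((kleinCoeffThree (X : ℤ[X])).coeff j) * X ^ 3
      + if j = 0 then 16777216 * X ^ 4 else 0 := by
  have h0 := map_kleinCoeffZero (mapRingHom (C : ℤ →+* ℤ[X])) X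
  have h1 := map_kleinCoeffOne (mapRingHom (C : ℤ →+* ℤ[X])) X
  have h2 := map_kleinCoeffTwo (mapRingHom (C : ℤ →+* ℤ[X])) X
  have h3 := map_kleinCoeffThree (mapRingHom (C : ℤ →+* ℤ[X])) X
  simp only [coe_mapRingHom, map_X] at h0 h1 h2 h3
  rw [kleinPolynomial, ← h0, ← h1, ← h2, ← h3]
  simp only [coeff_add, coeff_mul_C, coeff_map, coeff_C]

theorem natDegree_kleinCoeffZero : (kleinCoeffZero (X : ℤ[X])).natDegree = 20 := by
  unfold kleinCoeffZero
  compute_degree!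

theorem natDegree_kleinCoeffOne_le : (kleinCoeffOne (X : ℤ[X])).natDegree ≤ 15 := by
  unfold kleinCoeffOne
  compute_degree!

theorem natDegree_kleinCoeffTwo_le : (kleinCoeffTwo (X : ℤ[X])).natDegree ≤ 10 := by
  unfold kleinCoeffTwo
  compute_degree!

theorem natDegree_kleinCoeffThree_le : (kleinCoeffThree (X : ℤ[X])).natDegree ≤ 5 := by
  unfold kleinCoeffThree
  compute_degree!

/-- The parts in `x`, `x²`, `x³` have degree at most 15, 10, 5 in `y`, so the top degree in `y` is
decided by the part free of `x`. -/
theorem coeff_kleinPolynomial_of_le {j : ℕ} (hj : 20 ≤ j) :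
    kleinPolynomial.coeff j = C ((kleinCoeffZero (X : ℤ[X])).coeff j) := by
  have h1 := coeff_eq_zero_of_natDegree_lt (natDegree_kleinCoeffOne_le.trans_lt
    (show 15 < j by omega))
  have h2 := coeff_eq_zero_of_natDegree_lt (natDegree_kleinCoeffTwo_le.trans_lt
    (show 10 < j by omega))
  have h3 := coeff_eq_zero_of_natDegree_lt (natDegree_kleinCoeffThree_le.trans_lt
    (show 5 < j by omega))
  simp [coeff_kleinPolynomial, h1, h2, h3, show j ≠ 0 by omega]

theorem natDegree_kleinPolynomial : kleinPolynomial.natDegree = 20 := by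
  apply natDegree_eq_of_le_of_coeff_ne_zero
  · rw [natDegree_le_iff_coeff_eq_zero]
    intro j hj
    rw [coeff_kleinPolynomial_of_le hj.le, coeff_eq_zero_of_natDegree_lt
      (natDegree_kleinCoeffZero.trans_lt hj), C_0]
  · rw [coeff_kleinPolynomial_of_le le_rfl, Ne, C_eq_zero]
    have h : (kleinCoeffZero (X : ℤ[X])).leadingCoeff ≠ 0 := by
      rw [Ne, leadingCoeff_eq_zero]
      intro h
      simpa [h] using natDegree_kleinCoeffZero
    rwa [leadingCoeff, natDegree_kleinCoeffZero] at h

theorem degreeInX_kleinPolynomial : degreeInX kleinPolynomial = 4 := by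
  -- The term in `x⁴` is free of `y`, so the maximal degree in `x` is attained at `j = 0`.
  have hcoeff : (kleinPolynomial.coeff 0).coeff 4 = 16777216 := by
    simp [-eq_intCast, coeff_kleinPolynomial, coeff_X_pow, coeff_ofNat_mul]
  apply le_antisymm
  · refine Finset.sup_le fun j _ => ?_
    rw [coeff_kleinPolynomial]
    split_ifs <;> compute_degree!
  · have h0 : 0 ∈ kleinPolynomial.support := by
      rw [mem_support_iff]
      intro h
      simp [h] at hcoeff
    exact (le_natDegree_of_ne_zero (by simp [hcoeff])).trans
      (Finset.le_sup (f := fun j => (kleinPolynomial.coeff j).natDegree) h0)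

end Algebraic

theorem mainTheorem2 :
    IsAlgebraicSeries (gaussSeries (-1 / 60) (11 / 60) (2 / 3)) ∧
    IsAlgebraicSeries (gaussSeries (19 / 60) (31 / 60) (4 / 3)) ∧
    ∃ P : Polynomial (Polynomial ℤ), P.natDegree = 20 ∧ degreeInX P = 4 ∧
      substSeries P (gaussSeries (-1 / 60) (11 / 60) (2 / 3) ^ 12) = 0 := by
  obtain ⟨z, hz, h1, h2⟩ := exists_icosahedral_parameter
  have halg := isAlgebraic_of_icosahedral_parameter hz
  have hv : vertexForm z ≠ 0 := right_ne_zero_of_mul_eq_one h1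
  -- If `s(z)` vanished, `h2` would force `φ(z) ^ 19 = 0`.
  have hf : faceForm z ≠ 0 := by
    intro h
    rw [h, mul_zero, zero_pow (by norm_num)] at h2
    exact pow_ne_zero 19 hv h2.symm
  refine ⟨isAlgebraicSeries_of_isAlgebraic ?_, isAlgebraicSeries_of_isAlgebraic ?_,
    kleinPolynomial, natDegree_kleinPolynomial, degreeInX_kleinPolynomial,
    substSeries_kleinPolynomial hz h1⟩
  · refine IsAlgebraic.of_pow (n := 12) (by norm_num) (IsAlgebraic.of_mul
      (mem_nonZeroDivisors_of_ne_zero hv) halg.vertexForm ?_)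
    rw [mul_comm, h1]
    exact isAlgebraic_one
  · refine IsAlgebraic.of_mul (mem_nonZeroDivisors_of_ne_zero hf) halg.faceForm ?_
    rw [mul_comm]
    refine IsAlgebraic.of_pow (n := 12) (by norm_num) ?_
    rw [h2]
    exact halg.vertexForm.pow 19
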